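/- Notation. $2^\omega$ is the Cantor space with the product topology and $\mathrm{Fin}$ is the ideal of finite subsets of $2^\omega$. For $A\subseteq 2^\omega$, $[A]$ is the class of $A$ in the Boolean algebra $\mathcal P(2^\omega)/\mathrm{Fin}$, and an automorphism is an automorphism of this Boolean algebra. Let $\pi$ be an automorphism. - $\pi$ is *trivial* if there is a function $f:2^\omega\to 2^\omega$ such that $\pi([A])=[f^{-1}(A)]$ for all $A\subseteq 2^\omega$. - For $Z\subseteq 2^\omega$, $\pi$ is *trivial on $Z$* if there are a set $W\subseteq 2^\omega$ and a function $f:W\to Z$ such that $\pi([A])=[f^{-1}(A)]$ for all $A\subseteq Z$. - $\pi$ is *cardinality-preserving* if for every $A\subseteq 2^\omega$ there is $B\subseteq 2^\omega$ with $|A|=|B|$ and $\pi([A])=[B]$. For $\Gamma\subseteq\mathcal P(2^\omega)$, the *cofinal selection number* $\mathrm{CSN}(\Gamma)$ is the smallest cardinality of a family $\mathcal F\subseteq(2^\omega)^\omega\times(2^\omega)^\omega$ such that 1. for every $(f,g)\in\mathcal F$, the set $\{f(n):n<\omega\}\cup\{g(n):n<\omega\}$ is dense in $2^\omega$; 2.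 for all $(f,g),(f',g')\in\mathcal F$, if $g\neq g'$ then $\{g(n):n<\omega\}\cap\{g'(n):n<\omega\}=\emptyset$; 3. for every $(f,g)\in\mathcal F$ and $n<\omega$, $f(n)\neq g(n)$; 4. for every $A\in\Gamma$, the set of those $(f,g)\in\mathcal F$ for which $|A\cap\{f(n),g(n)\}|=1$ holds for infinitely many $n<\omega$ has cardinality smaller than $|\mathcal F|$; if such a family exists, and $\mathrm{CSN}(\Gamma)=(2^{\aleph_0})^+$ otherwise. $\mathbf{\Delta}^1_1$ is the class of subsets of $2^\omega$ that are both analytic and coanalytic, and $\mathrm{cov}(\mathcal M)$ is the least cardinality of a family of meager subsets of $2^\omega$ whose union is $2^\omega$. **Theorem.** (a) Assume $\mathrm{CSN}(\mathbf{\Delta}^1_1)>\omega_1$. Then every cardinality-preserving automorphism of $\mathcal P(2^\omega)/\mathrm{Fin}$ that is trivial on every countable subset of $2^\omega$ is trivial. (b) Assume $\mathrm{cov}(\mathcal M)>\omega_1$. Then every automorphism of $\mathcal P(2^\omega)/\mathrm{Fin}$ that is trivial on every countable subset of $2^\omega$ is trivial. -/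

import Mathlib

open Set
open scoped Cardinal

universe u

/-! ### The Boolean algebra `𝒫(X)/I` -/

/-- Two subsets of `X` are identified when their symmetric difference lies in the ideal `I`. -/
def idealSetoid {X : Type u} (I : Order.Ideal (Set X)) : Setoid (Set X) where
  r A B := (A \ B) ∪ (B \ A) ∈ I
  iseqv :=
    { refl := fun A => by simpa using I.bot_mem
      symm := fun {A B} h => by rwa [union_comm]
      trans := fun {A B C} h₁ h₂ =>
        I.lower (show (A \ C) ∪ (C \ A) ≤ ((A \ B) ∪ (B \ A)) ⊔ ((B \ C) ∪ (C \ B)) by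
          intro x
          simp only [mem_union, mem_sdiff, sup_eq_union]
          tauto) (I.sup_mem h₁ h₂) }

/-- The quotient `𝒫(X)/I`. -/
def PowMod {X : Type u} (I : Order.Ideal (Set X)) : Type u := Quotient (idealSetoid I)

namespace PowMod

variable {X : Type u} {I : Order.Ideal (Set X)}

/-- The class `[A]` of `A ⊆ X` in `𝒫(X)/I`. -/
def mk (I : Order.Ideal (Set X)) (A : Set X) : PowMod I := Quotient.mk (idealSetoid I) A

theorem mk_eq_mk {A B : Set X} : mk I A = mk I B ↔ (A \ B) ∪ (B \ A) ∈ I :=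
  ⟨fun h => Quotient.exact h, fun h => Quotient.sound (s := idealSetoid I) h⟩

theorem mk_surjective (a : PowMod I) : ∃ A, mk I A = a := Quotient.exists_rep a

/-- `[A] ≤ [B]` iff `A \ B ∈ I`. -/
instance : LE (PowMod I) where
  le := Quotient.lift₂ (fun A B => A \ B ∈ I) (by
    intro A B A' B' hA hB
    have hA : (A \ A') ∪ (A' \ A) ∈ I := hA
    have hB : (B \ B') ∪ (B' \ B) ∈ I := hB
    refine propext ⟨fun h => I.lower ?_ (I.sup_mem h (I.sup_mem hA hB)),
      fun h => I.lower ?_ (I.sup_mem h (I.sup_mem hA hB))⟩ <;>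
    · intro x
      simp only [mem_union, mem_sdiff, sup_eq_union]
      tauto)

/-- `[A] ⊔ [B] = [A ∪ B]`. -/
instance : Max (PowMod I) where
  max := Quotient.map₂ (· ∪ ·) (by
    intro A A' hA B B' hB
    have hA : (A \ A') ∪ (A' \ A) ∈ I := hA
    have hB : (B \ B') ∪ (B' \ B) ∈ I := hB
    refine I.lower ?_ (I.sup_mem hA hB)
    intro x
    simp only [mem_union, mem_sdiff, sup_eq_union]
    tauto)

/-- `[A] ⊓ [B] = [A ∩ B]`. -/
instance : Min (PowMod I) where
  min := Quotient.map₂ (· ∩ ·) (by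
    intro A A' hA B B' hB
    have hA : (A \ A') ∪ (A' \ A) ∈ I := hA
    have hB : (B \ B') ∪ (B' \ B) ∈ I := hB
    refine I.lower ?_ (I.sup_mem hA hB)
    intro x
    simp only [mem_union, mem_sdiff, mem_inter_iff, sup_eq_union]
    tauto)

/-- `[A]ᶜ = [X \ A]`. -/
instance : Compl (PowMod I) where
  compl := Quotient.map (fun A => Aᶜ) (by
    intro A A' hA
    have hA : (A \ A') ∪ (A' \ A) ∈ I := hA
    refine I.lower ?_ hA
    intro x
    simp only [mem_union, mem_sdiff, mem_compl_iff]
    tauto)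

theorem mk_le_mk {A B : Set X} : mk I A ≤ mk I B ↔ A \ B ∈ I := Iff.rfl

theorem mk_sup_mk (A B : Set X) : mk I A ⊔ mk I B = mk I (A ∪ B) := rfl

theorem mk_inf_mk (A B : Set X) : mk I A ⊓ mk I B = mk I (A ∩ B) := rfl

theorem compl_mk (A : Set X) : (mk I A)ᶜ = mk I Aᶜ := rfl

theorem mk_le_of_subset {A B : Set X} (h : A ⊆ B) : mk I A ≤ mk I B := by
  rw [mk_le_mk, sdiff_eq_empty.2 h]
  exact I.bot_mem

/-- `𝒫(X)/I` is a Boolean algebra, with the operations induced from `𝒫(X)`. -/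
instance : BooleanAlgebra (PowMod I) where
  le := (· ≤ ·)
  sup := (· ⊔ ·)
  inf := (· ⊓ ·)
  compl := (·ᶜ)
  top := mk I univ
  bot := mk I ∅
  le_refl a := by
    obtain ⟨A, rfl⟩ := mk_surjective a
    exact mk_le_of_subset subset_rfl
  le_trans a b c h₁ h₂ := by
    obtain ⟨A, rfl⟩ := mk_surjective a
    obtain ⟨B, rfl⟩ := mk_surjective b
    obtain ⟨C, rfl⟩ := mk_surjective c
    rw [mk_le_mk] at *
    refine I.lower ?_ (I.sup_mem h₁ h₂)
    intro x
    simp only [mem_union, mem_sdiff, sup_eq_union]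
    tauto
  le_antisymm a b h₁ h₂ := by
    obtain ⟨A, rfl⟩ := mk_surjective a
    obtain ⟨B, rfl⟩ := mk_surjective b
    rw [mk_le_mk] at *
    exact mk_eq_mk.2 (I.sup_mem h₁ h₂)
  le_sup_left a b := by
    obtain ⟨A, rfl⟩ := mk_surjective a
    obtain ⟨B, rfl⟩ := mk_surjective b
    exact mk_le_of_subset subset_union_left
  le_sup_right a b := by
    obtain ⟨A, rfl⟩ := mk_surjective a
    obtain ⟨B, rfl⟩ := mk_surjective b
    exact mk_le_of_subset subset_union_right
  sup_le a b c h₁ h₂ := by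
    obtain ⟨A, rfl⟩ := mk_surjective a
    obtain ⟨B, rfl⟩ := mk_surjective b
    obtain ⟨C, rfl⟩ := mk_surjective c
    rw [mk_le_mk] at h₁ h₂
    change mk I (A ∪ B) ≤ mk I C
    rw [mk_le_mk]
    refine I.lower ?_ (I.sup_mem h₁ h₂)
    intro x
    simp only [mem_union, mem_sdiff, sup_eq_union]
    tauto
  inf_le_left a b := by
    obtain ⟨A, rfl⟩ := mk_surjective a
    obtain ⟨B, rfl⟩ := mk_surjective b
    exact mk_le_of_subset inter_subset_left
  inf_le_right a b := by
    obtain ⟨A, rfl⟩ := mk_surjective a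
    obtain ⟨B, rfl⟩ := mk_surjective b
    exact mk_le_of_subset inter_subset_right
  le_inf a b c h₁ h₂ := by
    obtain ⟨A, rfl⟩ := mk_surjective a
    obtain ⟨B, rfl⟩ := mk_surjective b
    obtain ⟨C, rfl⟩ := mk_surjective c
    rw [mk_le_mk] at h₁ h₂
    change mk I A ≤ mk I (B ∩ C)
    rw [mk_le_mk]
    refine I.lower ?_ (I.sup_mem h₁ h₂)
    intro x
    simp only [mem_union, mem_sdiff, mem_inter_iff, sup_eq_union]
    tauto
  le_sup_inf a b c := by
    obtain ⟨A, rfl⟩ := mk_surjective a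
    obtain ⟨B, rfl⟩ := mk_surjective b
    obtain ⟨C, rfl⟩ := mk_surjective c
    exact mk_le_of_subset (union_inter_distrib_left A B C).ge
  le_top a := by
    obtain ⟨A, rfl⟩ := mk_surjective a
    exact mk_le_of_subset (subset_univ A)
  bot_le a := by
    obtain ⟨A, rfl⟩ := mk_surjective a
    exact mk_le_of_subset (empty_subset A)
  inf_compl_le_bot a := by
    obtain ⟨A, rfl⟩ := mk_surjective a
    exact mk_le_of_subset (inter_compl_self A).le
  top_le_sup_compl a := by
    obtain ⟨A, rfl⟩ := mk_surjective a
    exact mk_le_of_subset (union_compl_self A).ge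

end PowMod

/-- The ideal `Fin` of finite subsets of `X`. -/
def finIdeal (X : Type u) : Order.Ideal (Set X) where
  carrier := {A | A.Finite}
  lower' := fun _ _ hBA hA => Set.Finite.subset hA hBA
  nonempty' := ⟨∅, finite_empty⟩
  directed' := fun A hA B hB => ⟨A ∪ B, Set.Finite.union hA hB, subset_union_left,
    subset_union_right⟩

/-! ### Triviality and preservation of cardinalities -/

section Maps

variable {X Y : Type u} {I : Order.Ideal (Set X)} {J : Order.Ideal (Set Y)}

/-- `π : 𝒫(X)/I → 𝒫(Y)/J` is trivial if it is induced by a function `f : Y → X`, that is,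
`π [A] = [f⁻¹(A)]` for all `A ⊆ X`. -/
def IsTrivial (π : PowMod I → PowMod J) : Prop :=
  ∃ f : Y → X, ∀ A : Set X, π (PowMod.mk I A) = PowMod.mk J (f ⁻¹' A)

/-- `π : 𝒫(X)/I → 𝒫(Y)/J` is trivial on `Z ⊆ X` if there is a function `f` into `Z`, defined on
some `W ⊆ Y`, such that `π [A] = [f⁻¹(A)]` for all `A ⊆ Z`. (Taking `A = Z`, the domain `W` is
necessarily a representative of `π [Z]`.) -/
def IsTrivialOn (π : PowMod I → PowMod J) (Z : Set X) : Prop :=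
  ∃ (W : Set Y) (f : W → Z), ∀ A : Set X, A ⊆ Z →
    π (PowMod.mk I A) = PowMod.mk J (Subtype.val '' {y : W | (f y : X) ∈ A})

/-- `π` is cardinality-preserving if for every `A ⊆ X` there is `B ⊆ Y` with `|A| = |B|` and
`π [A] = [B]`. -/
def IsCardPreserving (π : PowMod I → PowMod J) : Prop :=
  ∀ A : Set X, ∃ B : Set Y, #A = #B ∧ π (PowMod.mk I A) = PowMod.mk J B

end Maps

/-! ### Cardinal characteristics -/

/-- The Cantor space `2^ω`, with the product topology. -/
abbrev CantorSpace : Type := ℕ → Bool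

/-- The boldface pointclass `Δ¹₁` on `2^ω`: the sets that are both analytic and coanalytic. -/
def boldDelta11 : Set (Set CantorSpace) :=
  {A | MeasureTheory.AnalyticSet A ∧ MeasureTheory.AnalyticSet Aᶜ}

/-- The families of pairs of sequences over which the cofinal selection number of `Γ` is
minimized. -/
structure IsCSNFamily (Γ : Set (Set CantorSpace))
    (F : Set ((ℕ → CantorSpace) × (ℕ → CantorSpace))) : Prop where
  dense : ∀ p ∈ F, Dense (range p.1 ∪ range p.2)
  disjoint : ∀ p ∈ F, ∀ q ∈ F, p.2 ≠ q.2 → Disjoint (range p.2) (range q.2)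
  ne : ∀ p ∈ F, ∀ n : ℕ, p.1 n ≠ p.2 n
  small : ∀ A ∈ Γ,
    #{p | p ∈ F ∧ ∃ᶠ n in Filter.atTop, (A ∩ {p.1 n, p.2 n}).ncard = 1} < #F

open Classical in
/-- The cofinal selection number `CSN(Γ)`. -/
noncomputable def CSN (Γ : Set (Set CantorSpace)) : Cardinal.{0} :=
  if ∃ F, IsCSNFamily Γ F then sInf {κ | ∃ F, IsCSNFamily Γ F ∧ #F = κ}
  else Order.succ ((2 : Cardinal.{0}) ^ ℵ₀)

/-- The covering number `cov(ℳ)` of the ideal of meager subsets of `2^ω`. -/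
noncomputable def covMeager : Cardinal.{0} :=
  sInf {κ | ∃ C : Set (Set CantorSpace), (∀ M ∈ C, IsMeagre M) ∧ ⋃₀ C = univ ∧ #C = κ}

/-! Only one map can induce π, up to a small error: if `B n` represents the image of {x | x n =
true}, let F y be the point whose n-th digit says whether y ∈ `B n`. Triviality on countable sets
makes π send countable sets to countable ones, hence respect countable unions modulo countable sets
(`CountablyRepresents.iUnion`). So F⁻¹(A) represents π[A] up to a countable set for every Borel A.

If, off countable sets, F agrees modulo finite with every map inducing π on a countable set, then
correcting F on a countable set gives a map inducing π (`isTrivial_of_almost_agrees`); this needs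
π⁻¹ to preserve countability. Otherwise Zorn's lemma yields ℵ₁ disjoint deviations (x, y): y n
follows x n along π, yet F (y n) ≠ x n. A Borel set A separates F (y n) from x n infinitely often
only if y meets the countable error of F⁻¹(A), hence for only countably many deviations. Once spread
out to become dense, these pairs witness CSN(Δ¹₁) ≤ ℵ₁.

In (a), preservation of cardinality handles π⁻¹. In (b), a point generic for ℵ₁ comeager
requirements does two things: it codes an open set separating infinitely many pairs of each
sequence, so CSN(Δ¹₁) > ℵ₁, and it codes a function agreeing infinitely often with each of ℵ₁ given
ones, which handles π⁻¹. -/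

/-! ### Representatives of images, and Borel sets modulo countable sets. -/

section Representatives

variable {X Y : Type u}

/-- `B` represents the image under `π` of the class of `A`. -/
def Represents (π : PowMod (finIdeal X) ≃o PowMod (finIdeal Y)) (A : Set X) (B : Set Y) : Prop :=
  π (PowMod.mk (finIdeal X) A) = PowMod.mk (finIdeal Y) B

theorem mk_finIdeal_le {A B : Set X} :
    PowMod.mk (finIdeal X) A ≤ PowMod.mk (finIdeal X) B ↔ (A \ B).Finite := Iff.rfl

theorem mk_finIdeal_eq {A B : Set X} :
    PowMod.mk (finIdeal X) A = PowMod.mk (finIdeal X) B ↔ (A \ B).Finite ∧ (B \ A).Finite :=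
  le_antisymm_iff

/-- An order isomorphism `π`, with the orders derived from the Boolean algebra structures. -/
def toBooleanIso (π : PowMod (finIdeal X) ≃o PowMod (finIdeal Y)) :
    @OrderIso (PowMod (finIdeal X)) (PowMod (finIdeal Y)) Preorder.toLE Preorder.toLE := π

variable {π : PowMod (finIdeal X) ≃o PowMod (finIdeal Y)}

theorem exists_represents (π : PowMod (finIdeal X) ≃o PowMod (finIdeal Y)) (A : Set X) :
    ∃ B, Represents π A B :=
  (PowMod.mk_surjective (π (PowMod.mk _ A))).imp fun _ h => h.symm

theorem exists_represents_of_image (π : PowMod (finIdeal X) ≃o PowMod (finIdeal Y)) (B : Set Y) :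
    ∃ A, Represents π A B := by
  obtain ⟨A, hA⟩ := PowMod.mk_surjective (π.symm (PowMod.mk _ B))
  exact ⟨A, by rw [Represents, hA, OrderIso.apply_symm_apply]⟩

namespace Represents

variable {A A' : Set X} {B B' : Set Y}

theorem finite_diff_iff (h : Represents π A B) (h' : Represents π A' B') :
    (A \ A').Finite ↔ (B \ B').Finite := by
  rw [← mk_finIdeal_le, ← mk_finIdeal_le, ← h, ← h', π.le_iff_le]

theorem compl (h : Represents π A B) : Represents π Aᶜ Bᶜ := by
  unfold Represents at *
  rw [← PowMod.compl_mk, ← PowMod.compl_mk, ← h]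
  exact map_compl' (toBooleanIso π) _

theorem inter (h : Represents π A B) (h' : Represents π A' B') :
    Represents π (A ∩ A') (B ∩ B') := by
  unfold Represents at *
  rw [← PowMod.mk_inf_mk, ← PowMod.mk_inf_mk, ← h, ← h']
  exact OrderIso.map_inf (toBooleanIso π) _ _

theorem finite_inter_iff (h : Represents π A B) (h' : Represents π A' B') :
    (A ∩ A').Finite ↔ (B ∩ B').Finite := by
  simpa [sdiff_eq] using h.finite_diff_iff h'.compl

theorem finite_iff (h : Represents π A B) : A.Finite ↔ B.Finite := by
  simpa using h.finite_inter_iff h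

theorem congr_left (h : Represents π A B) (h₁ : (A \ A').Finite) (h₂ : (A' \ A).Finite) :
    Represents π A' B := by
  unfold Represents at *
  rw [← h, mk_finIdeal_eq.2 ⟨h₁, h₂⟩]

theorem finite_diff_right (h : Represents π A B) (h' : Represents π A B') : (B \ B').Finite :=
  (h.finite_diff_iff h').1 (by simp)

end Represents

/-- The map `f` induces `π` below the class of `W`. -/
structure InducesOn (π : PowMod (finIdeal X) ≃o PowMod (finIdeal Y)) (Z : Set X) (W : Set Y)
    (f : Y → X) : Prop where
  represents : Represents π Z W
  mapsTo : MapsTo f W Z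
  finite : ∀ A B, Represents π A B → {y | y ∈ W ∧ ¬(f y ∈ A ↔ y ∈ B)}.Finite

theorem IsTrivialOn.exists_inducesOn [Nonempty X] {Z : Set X} (h : IsTrivialOn π Z) :
    ∃ W f, InducesOn π Z W f := by
  classical
  obtain ⟨W, f, hf⟩ := h
  have hW : Represents π Z W := by
    have := hf Z subset_rfl
    rw [Represents, this]
    congr 1
    ext y
    simp
  refine ⟨W, fun y => if hy : y ∈ W then f ⟨y, hy⟩ else Classical.arbitrary X, hW, ?_, ?_⟩
  · intro y hy
    simp [hy]
  · intro A B hAB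
    have h₁ : Represents π (A ∩ Z) (B ∩ W) := hAB.inter hW
    have h₂ : Represents π (A ∩ Z) (Subtype.val '' {y : W | (f y : X) ∈ A ∩ Z}) :=
      hf _ inter_subset_right
    refine ((h₁.finite_diff_right h₂).union (h₂.finite_diff_right h₁)).subset ?_
    rintro y ⟨hy, hn⟩
    simp only [hy, dif_pos] at hn
    simp only [mem_union, mem_sdiff, mem_inter_iff, mem_image, mem_ofPred_eq, Subtype.exists,
      exists_and_right, exists_eq_right, hy, exists_true_left, Subtype.coe_prop, and_true]
    tauto

/-- A singleton has a finite image, and the fibre lies in it up to finitely many points. -/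
theorem InducesOn.finite_fiber {Z : Set X} {W : Set Y} {f : Y → X} (h : InducesOn π Z W f)
    (x : X) : {y | y ∈ W ∧ f y = x}.Finite := by
  obtain ⟨B, hB⟩ := exists_represents π {x}
  have hBf : B.Finite := hB.finite_iff.1 (finite_singleton x)
  refine ((h.finite _ _ hB).union hBf).subset ?_
  rintro y ⟨hy, hx⟩
  by_cases hyB : y ∈ B
  · exact Or.inr hyB
  · exact Or.inl ⟨hy, by simp [hx, hyB]⟩

theorem InducesOn.countable {Z : Set X} {W : Set Y} {f : Y → X} (h : InducesOn π Z W f)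
    (hZ : Z.Countable) : W.Countable := by
  refine (hZ.biUnion fun x _ => (h.finite_fiber x).countable).mono fun y hy => ?_
  simp only [mem_iUnion]
  exact ⟨f y, h.mapsTo hy, hy, rfl⟩

/-- Every representative of the image of a countable set is countable. -/
theorem Represents.countable [Nonempty X]
    (htriv : ∀ Z : Set X, Z.Countable → IsTrivialOn π Z)
    {A : Set X} {B : Set Y} (h : Represents π A B) (hA : A.Countable) : B.Countable := by
  obtain ⟨W, f, hf⟩ := (htriv A hA).exists_inducesOn
  refine ((hf.countable hA).union (h.finite_diff_right hf.represents).countable).mono ?_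
  intro y hy
  by_cases hyW : y ∈ W
  · exact Or.inl hyW
  · exact Or.inr ⟨hy, hyW⟩

/-- `B` represents the image of `A` up to a countable set. -/
def CountablyRepresents (π : PowMod (finIdeal X) ≃o PowMod (finIdeal Y)) (A : Set X)
    (B : Set Y) : Prop :=
  ∃ B', Represents π A B' ∧ (symmDiff B' B).Countable

theorem Represents.countablyRepresents {A : Set X} {B : Set Y} (h : Represents π A B) :
    CountablyRepresents π A B :=
  ⟨B, h, by simp⟩

namespace CountablyRepresents

theorem compl {A : Set X} {B : Set Y} (h : CountablyRepresents π A B) :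
    CountablyRepresents π Aᶜ Bᶜ := by
  obtain ⟨B', h, hB⟩ := h
  exact ⟨B'ᶜ, h.compl, by rwa [compl_symmDiff_compl]⟩

theorem inter {A A' : Set X} {B B' : Set Y} (h : CountablyRepresents π A B)
    (h' : CountablyRepresents π A' B') : CountablyRepresents π (A ∩ A') (B ∩ B') := by
  obtain ⟨C, h, hB⟩ := h
  obtain ⟨C', h', hB'⟩ := h'
  refine ⟨C ∩ C', h.inter h', (hB.union hB').mono ?_⟩
  intro y
  simp only [mem_symmDiff, mem_inter_iff, mem_union]
  tauto

/-- The excess of the image of the union over the union of the images is itself the image of some D.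
This D is almost inside the union and almost disjoint from each A n, hence countable, and then so is
its image. -/
theorem iUnion [Nonempty X] (htriv : ∀ Z : Set X, Z.Countable → IsTrivialOn π Z)
    {A : ℕ → Set X} {B : ℕ → Set Y} (h : ∀ n, CountablyRepresents π (A n) (B n)) :
    CountablyRepresents π (⋃ n, A n) (⋃ n, B n) := by
  choose C hC hCB using h
  obtain ⟨C', hC'⟩ := exists_represents π (⋃ n, A n)
  obtain ⟨D, hD⟩ := exists_represents_of_image π (C' \ ⋃ n, C n)
  have h₁ : (D \ ⋃ n, A n).Finite := by
    rw [hD.finite_diff_iff hC', sdiff_eq_empty.2 sdiff_subset]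
    exact finite_empty
  have h₂ : ∀ n, (D ∩ A n).Finite := fun n => by
    rw [hD.finite_inter_iff (hC n)]
    convert finite_empty
    ext y
    simp only [mem_inter_iff, mem_sdiff, mem_iUnion, mem_empty_iff_false]
    grind
  have hDc : D.Countable := by
    refine (h₁.countable.union (countable_iUnion fun n => (h₂ n).countable)).mono fun x hx => ?_
    simp only [mem_union, mem_sdiff, mem_iUnion, mem_inter_iff]
    grind
  have h₃ : ∀ n, (C n \ C').Finite := fun n => by
    rw [← (hC n).finite_diff_iff hC', sdiff_eq_empty.2 (subset_iUnion A n)]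
    exact finite_empty
  refine ⟨C', hC', ((hD.countable htriv hDc).union
    ((countable_iUnion hCB).union (countable_iUnion fun n => (h₃ n).countable))).mono ?_⟩
  intro y
  simp only [mem_symmDiff, mem_union, mem_sdiff, mem_iUnion]
  grind

/-- Maps that correspond to each other on a generating family of sets, up to countable sets, do so
on every measurable set. -/
theorem preimage [Nonempty X] (htriv : ∀ Z : Set X, Z.Countable → IsTrivialOn π Z)
    {φ : X → CantorSpace} {φ' : Y → CantorSpace}
    (h : ∀ n, CountablyRepresents π {x | φ x n = true} {y | φ' y n = true})
    {A : Set CantorSpace} (hA : MeasurableSet A) :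
    CountablyRepresents π (φ ⁻¹' A) (φ' ⁻¹' A) := by
  -- The sets with the required property form a σ-algebra, which contains the subbasic cylinders.
  let m : MeasurableSpace CantorSpace :=
    { MeasurableSet' := fun A => CountablyRepresents π (φ ⁻¹' A) (φ' ⁻¹' A)
      measurableSet_empty := by
        refine Represents.countablyRepresents ?_
        exact OrderIso.map_bot (toBooleanIso π)
      measurableSet_compl := fun A hA => hA.compl
      measurableSet_iUnion := fun A hA => by
        rw [preimage_iUnion, preimage_iUnion]
        exact iUnion htriv hA }
  have hm : (MeasurableSpace.pi : MeasurableSpace CantorSpace) ≤ m := by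
    refine iSup_le fun n => ?_
    rintro _ ⟨s, -, rfl⟩
    have ht : @MeasurableSet _ m {z : CantorSpace | z n = true} := h n
    have hf : @MeasurableSet _ m {z : CantorSpace | z n = false} := by
      convert ht.compl using 1
      ext z
      simp
    have : (fun z : CantorSpace => z n) ⁻¹' s =
        (⋃ (_ : true ∈ s), {z : CantorSpace | z n = true}) ∪
          ⋃ (_ : false ∈ s), {z : CantorSpace | z n = false} := by
      ext z
      rcases hz : z n <;> simp [hz]
    rw [this]
    exact (MeasurableSet.iUnion fun _ => ht).union (MeasurableSet.iUnion fun _ => hf)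
  exact hm A hA

end CountablyRepresents

end Representatives

/-! ### Deviations from the candidate map. -/

section Deviations

variable {X Y : Type u} {π : PowMod (finIdeal X) ≃o PowMod (finIdeal Y)}

/-- If, outside countable sets, `F` almost agrees with every function inducing `π` on a countable
set, then `π` is trivial. -/
theorem isTrivial_of_almost_agrees [Nonempty X]
    (htriv : ∀ Z : Set X, Z.Countable → IsTrivialOn π Z)
    (hrev : ∀ A B, Represents π A B → B.Countable → A.Countable)
    (F : Y → X) {S : Set X} {T : Set Y} (hS : S.Countable) (hT : T.Countable)
    (hF : ∀ Z : Set X, Z.Countable → Disjoint Z S → ∀ W f, InducesOn π Z W f →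
      {y | y ∈ W ∧ y ∉ T ∧ f y ≠ F y}.Finite) :
    IsTrivial π := by
  classical
  obtain ⟨D, hD⟩ := exists_represents_of_image π T
  -- The correction `f₁` takes care of both exceptional sets: its domain almost contains T, and
  -- anything missing its domain has a preimage almost disjoint from S.
  obtain ⟨W₁, f₁, hf₁⟩ := (htriv (S ∪ D) (hS.union (hrev _ _ hD hT))).exists_inducesOn
  have hTW : (T \ W₁).Finite := by
    rw [← hD.finite_diff_iff hf₁.represents, sdiff_eq_empty.2 subset_union_right]
    exact finite_empty
  refine ⟨fun y => if y ∈ W₁ then f₁ y else F y, fun A => ?_⟩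
  obtain ⟨B, hB⟩ := exists_represents π A
  -- An infinite set of errors would contain a countable one, C, whose preimage can be trimmed to
  -- avoid S. A map inducing π there is almost equal to F on C and almost correct for A and B, a
  -- contradiction.
  have hE : {y | y ∉ W₁ ∧ y ∉ T ∧ ¬(F y ∈ A ↔ y ∈ B)}.Finite := by
    by_contra hinf
    let C : Set Y := range fun n => (Set.Infinite.natEmbedding _ hinf n : Y)
    have hCinf : C.Infinite := infinite_range_of_injective
      (Subtype.val_injective.comp (Set.Infinite.natEmbedding _ hinf).injective)
    have hCmem : ∀ y ∈ C, y ∉ W₁ ∧ y ∉ T ∧ ¬(F y ∈ A ↔ y ∈ B) := by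
      rintro _ ⟨n, rfl⟩
      exact (Set.Infinite.natEmbedding _ hinf n).2
    obtain ⟨D₀, hD₀⟩ := exists_represents_of_image π C
    have hfin : (D₀ ∩ (S ∪ D)).Finite := by
      rw [hD₀.finite_inter_iff hf₁.represents]
      convert finite_empty
      exact eq_empty_of_forall_notMem fun y hy => (hCmem y hy.1).1 hy.2
    have hD₁ : Represents π (D₀ \ (S ∪ D)) C :=
      hD₀.congr_left (by simpa [sdiff_sdiff_right_self] using hfin)
        (by rw [sdiff_eq_empty.2 sdiff_subset]; exact finite_empty)
    have hD₁c := hrev _ _ hD₁ (countable_range _)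
    obtain ⟨W, f, hf⟩ := (htriv _ hD₁c).exists_inducesOn
    refine hCinf (((hD₁.finite_diff_right hf.represents).union
      ((hF _ hD₁c ?_ W f hf).union (hf.finite A B hB))).subset fun y hy => ?_)
    · exact disjoint_sdiff_left.mono_right subset_union_left
    · have := hCmem y hy
      by_cases hyW : y ∈ W
      · right
        by_cases hfy : f y = F y
        · exact Or.inr ⟨hyW, by rw [hfy]; exact this.2.2⟩
        · exact Or.inl ⟨hyW, this.2.1, hfy⟩
      · exact Or.inl ⟨hy, hyW⟩
  have hfin : {y | ¬((if y ∈ W₁ then f₁ y else F y) ∈ A ↔ y ∈ B)}.Finite := by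
    refine ((hf₁.finite A B hB).union (hTW.union hE)).subset fun y hy => ?_
    simp only [mem_union, mem_ofPred_eq, mem_sdiff] at hy ⊢
    by_cases hyW : y ∈ W₁
    · exact Or.inl ⟨hyW, by simpa [hyW] using hy⟩
    · simp only [hyW, if_false] at hy
      grind
  rw [show π (PowMod.mk _ A) = PowMod.mk _ B from hB, mk_finIdeal_eq]
  constructor <;>
  · refine hfin.subset fun y hy => ?_
    simp only [mem_sdiff, mem_preimage, mem_ofPred_eq] at hy ⊢
    tauto

/-- The sequence `y` follows `x` along `π`, and `F` differs from the assignment `y n ↦ x n`. -/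
structure IsDeviation (π : PowMod (finIdeal X) ≃o PowMod (finIdeal Y)) (F : Y → X)
    (x : ℕ → X) (y : ℕ → Y) : Prop where
  injective_left : Function.Injective x
  injective_right : Function.Injective y
  eventually_iff : ∀ A B, Represents π A B → ∀ᶠ n in Filter.atTop, (x n ∈ A ↔ y n ∈ B)
  ne : ∀ n, F (y n) ≠ x n

/-- Since fibres are finite, infinitely many disagreements take infinitely many values; one point
for each value makes both sequences injective. -/
theorem InducesOn.exists_isDeviation {F : Y → X} {Z : Set X} {W : Set Y} {f : Y → X}
    (hf : InducesOn π Z W f) {T : Set Y} (hinf : {y | y ∈ W ∧ y ∉ T ∧ f y ≠ F y}.Infinite) :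
    ∃ x y, IsDeviation π F x y ∧ range x ⊆ Z ∧ Disjoint (range y) T := by
  set I := {y | y ∈ W ∧ y ∉ T ∧ f y ≠ F y} with hI
  have himg : (f '' I).Infinite := by
    intro hfin
    refine hinf ((hfin.biUnion fun x _ => hf.finite_fiber x).subset fun y hy => ?_)
    simp only [mem_iUnion]
    exact ⟨f y, ⟨y, hy, rfl⟩, hy.1, rfl⟩
  set x : ℕ ↪ f '' I := Set.Infinite.natEmbedding _ himg
  choose y hyI hyx using fun n => (x n).2
  have hx : Function.Injective fun n => (x n : X) := Subtype.val_injective.comp x.injective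
  have hy : Function.Injective y := fun m n h => hx (by simp only [← hyx, h])
  refine ⟨fun n => x n, y, ⟨hx, hy, fun A B hAB => ?_, fun n => ?_⟩, ?_, ?_⟩
  · rw [← Nat.cofinite_eq_atTop]
    refine ((hf.finite A B hAB).preimage hy.injOn).subset fun n hn => ?_
    simp only [mem_compl_iff, mem_ofPred_eq, mem_preimage, hyx] at hn ⊢
    exact ⟨(hyI n).1, hn⟩
  · rw [← hyx n]
    exact (hyI n).2.2.symm
  · rintro _ ⟨n, rfl⟩
    simp only [← hyx n]
    exact hf.mapsTo (hyI n).1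
  · rw [Set.disjoint_left]
    rintro _ ⟨n, rfl⟩
    exact (hyI n).2.1

/-- Countable sets that can be found disjoint from any given countable set come in disjoint
families of size `ℵ₁`. -/
theorem exists_pairwiseDisjoint_mk_eq_aleph_one {α β : Type u} (s : α → Set β) (P : α → Prop)
    (hs : ∀ a, P a → (s a).Countable) (hne : ∀ a, (s a).Nonempty)
    (h : ∀ S : Set β, S.Countable → ∃ a, P a ∧ Disjoint (s a) S) :
    ∃ M : Set α, (∀ a ∈ M, P a) ∧ M.PairwiseDisjoint s ∧ #M = ℵ₁ := by
  obtain ⟨M, hM⟩ := zorn_subset {M : Set α | (∀ a ∈ M, P a) ∧ M.PairwiseDisjoint s} (by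
    intro c hc hchain
    refine ⟨⋃₀ c, ⟨?_, ?_⟩, fun t ht => subset_sUnion_of_mem ht⟩
    · rintro a ⟨t, ht, hat⟩
      exact (hc ht).1 a hat
    · exact (pairwiseDisjoint_sUnion hchain.directedOn).2 fun t ht => (hc ht).2)
  -- A countable maximal family could be enlarged by a set avoiding its union; nonemptiness ensures
  -- that this set is new.
  have hunc : ¬M.Countable := by
    intro hMc
    obtain ⟨a, ha, hdisj⟩ := h (⋃ b ∈ M, s b) (hMc.biUnion fun b hb => hs b (hM.1.1 b hb))
    rw [disjoint_iUnion₂_right] at hdisj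
    have haM : a ∈ M := by
      refine hM.2 ⟨?_, ?_⟩ (subset_insert a M) (mem_insert a M)
      · rintro b (rfl | hb)
        exacts [ha, hM.1.1 b hb]
      · exact hM.1.2.insert fun b hb _ => hdisj b hb
    exact (hne a).ne_empty (disjoint_self.1 (hdisj a haM))
  have hle : ℵ₁ ≤ #M := by
    rw [← Cardinal.succ_aleph0, Order.succ_le_iff, ← not_le, Cardinal.le_aleph0_iff_set_countable]
    exact hunc
  obtain ⟨M', hM', hcard⟩ := Cardinal.le_mk_iff_exists_subset.1 hle
  exact ⟨M', fun a ha => hM.1.1 a (hM' ha), hM.1.2.subset hM', hcard⟩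

end Deviations

/-! ### Spreading points over all basic open sets. -/

section Spread

/-- Injections of the Cantor space, with disjoint ranges for different `k`, sending all points
into the `k`-th basic open set. -/
def spread (k : ℕ) (x : CantorSpace) : CantorSpace := fun m =>
  if m < k then k.testBit m
  else if m.unpair.1 = 0 then decide (m.unpair.2 = k) else x (m.unpair.1 - 1)

theorem spread_eq_testBit {k m : ℕ} (x : CantorSpace) (h : m < k) :
    spread k x m = k.testBit m := if_pos h

/-- Each digit of x is repeated infinitely often, so a copy survives beyond the overwritten prefix
of length k. -/
theorem spread_injective (k : ℕ) : Function.Injective (spread k) := by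
  intro x x' h
  funext i
  have := congrFun h (Nat.pair (i + 1) k)
  have hk : ¬Nat.pair (i + 1) k < k := not_lt.2 (Nat.right_le_pair _ _)
  simpa [spread, hk] using this

/-- The places coded by pairs (0, j) mark the index k; the place for j = l lies beyond both prefixes
once k ≤ l. -/
theorem eq_of_spread_eq {k l : ℕ} {x x' : CantorSpace} (h : spread k x = spread l x') :
    k = l := by
  wlog hkl : k ≤ l generalizing k l x x'
  · exact (this h.symm (le_of_not_ge hkl)).symm
  have := congrFun h (Nat.pair 0 l)
  have h₁ : ¬Nat.pair 0 l < l := not_lt.2 (Nat.right_le_pair 0 l)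
  have h₂ : ¬Nat.pair 0 l < k := not_lt.2 (hkl.trans (Nat.right_le_pair 0 l))
  simpa [spread, h₁, h₂, eq_comm] using this

theorem measurable_spread (k : ℕ) : Measurable (spread k) := by
  refine measurable_pi_iff.2 fun m => ?_
  unfold spread
  split_ifs
  exacts [measurable_const, measurable_const, measurable_pi_apply _]

theorem dense_of_forall_prefix {s : Set CantorSpace}
    (h : ∀ (z : CantorSpace) (L : ℕ), ∃ x ∈ s, ∀ m < L, x m = z m) : Dense s := by
  intro z
  rw [mem_closure_iff]
  intro U hU hz
  obtain ⟨I, u, hu, hIU⟩ := isOpen_pi_iff.1 hU z hz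
  obtain ⟨x, hxs, hx⟩ := h z (I.sup id + 1)
  refine ⟨x, hIU fun i hi => ?_, hxs⟩
  rw [hx i (Nat.lt_succ_of_le (Finset.le_sup (f := id) hi))]
  exact (hu i hi).2

theorem dense_of_spread {s : Set CantorSpace} (h : ∀ k, ∃ x, spread k x ∈ s) : Dense s := by
  refine dense_of_forall_prefix fun z L => ?_
  obtain ⟨k, hLk, hk⟩ : ∃ k : ℕ, L ≤ k ∧ ∀ m < L, k.testBit m = z m := by
    -- Adding 2 ^ L makes k at least L and leaves the first L binary digits alone.
    refine ⟨Nat.ofBits (n := L) (fun i => z i) + 2 ^ L, ?_, ?_⟩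
    · exact (Nat.lt_two_pow_self (n := L)).le.trans (Nat.le_add_left _ _)
    · intro m hm
      rw [add_comm, Nat.testBit_two_pow_add_gt hm, Nat.testBit_ofBits_lt _ _ hm]
  obtain ⟨x, hx⟩ := h k
  exact ⟨_, hx, fun m hm => by rw [spread_eq_testBit x (hm.trans_le hLk), hk m hm]⟩

/-- The position of the first `true` in a binary sequence. -/
noncomputable def firstTrue (c : CantorSpace) : ℕ := sInf {m | c m = true}

theorem measurableSet_firstTrue_eq (k : ℕ) : MeasurableSet {c | firstTrue c = k} := by
  have heval : ∀ j, MeasurableSet {c : CantorSpace | c j = true} := fun j =>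
    measurableSet_eq_fun (measurable_pi_apply j) measurable_const
  -- The second piece accounts for the constantly false sequence, where `sInf ∅ = 0`.
  have : {c | firstTrue c = k} =
      ({c | c k = true} ∩ ⋂ j < k, {c : CantorSpace | c j = true}ᶜ) ∪
        ⋃ (_ : k = 0), ⋂ j, {c : CantorSpace | c j = true}ᶜ := by
    ext c
    simp only [firstTrue, mem_ofPred_eq, mem_union, mem_inter_iff, mem_iInter, mem_compl_iff,
      mem_iUnion, exists_prop]
    constructor
    · rintro rfl
      rcases eq_empty_or_nonempty {m | c m = true} with he | hne
      · exact Or.inr ⟨by rw [he, Nat.sInf_empty], fun j hj => by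
          have : j ∈ {m | c m = true} := hj
          simp [he] at this⟩
      · exact Or.inl ⟨Nat.sInf_mem hne, fun j hj => Nat.notMem_of_lt_sInf hj⟩
    · rintro (⟨hk, hlt⟩ | ⟨rfl, hall⟩)
      · refine le_antisymm (Nat.sInf_le hk) (le_csInf ⟨k, hk⟩ fun j hj => ?_)
        by_contra hjk
        exact hlt j (not_le.1 hjk) hj
      · rw [Nat.sInf_eq_zero]
        exact Or.inr (eq_empty_of_forall_notMem hall)
  rw [this]
  refine ((heval k).inter ?_).union ?_
  · exact MeasurableSet.iInter fun j => MeasurableSet.iInter fun _ => (heval j).compl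
  · exact MeasurableSet.iUnion fun _ => MeasurableSet.iInter fun j => (heval j).compl

end Spread

/-! ### From deviations to a cofinal selection family. -/

section CofinalSelection

/-- This colouring takes every value infinitely often along each sequence, so spreading by colour
will make every sequence dense. -/
theorem exists_forall_eq_unpair {α X : Type u} {M : Set α} (x : α → ℕ → X)
    (hinj : ∀ p ∈ M, Function.Injective (x p))
    (hdisj : ∀ p ∈ M, ∀ q ∈ M, p ≠ q → Disjoint (range (x p)) (range (x q))) :
    ∃ κ : X → ℕ, ∀ p ∈ M, ∀ n, κ (x p n) = n.unpair.1 := by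
  classical
  refine ⟨fun z => if h : ∃ q : α × ℕ, q.1 ∈ M ∧ x q.1 q.2 = z then h.choose.2.unpair.1 else 0,
    fun p hp n => ?_⟩
  have h : ∃ q : α × ℕ, q.1 ∈ M ∧ x q.1 q.2 = x p n := ⟨(p, n), hp, rfl⟩
  obtain ⟨h₁, h₂⟩ := h.choose_spec
  have hq : h.choose.1 = p := by
    by_contra hne
    exact Set.disjoint_left.1 (hdisj _ h₁ _ hp hne) ⟨_, h₂⟩ ⟨n, rfl⟩
  rw [hq] at h₂
  simp only [dif_pos h, hinj p hp h₂]

theorem Set.PairwiseDisjoint.countable_of_inter_nonempty {ι β : Type*} {s : ι → Set β}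
    {J : Set ι} {C : Set β} (hJ : J.PairwiseDisjoint s) (hC : C.Countable)
    (h : ∀ i ∈ J, (s i ∩ C).Nonempty) : J.Countable := by
  rcases J.eq_empty_or_nonempty with rfl | ⟨i₀, hi₀⟩
  · exact countable_empty
  have : Nonempty β := ⟨(h i₀ hi₀).some⟩
  choose! g hg using h
  refine MapsTo.countable_of_injOn (fun i hi => (hg i hi).2) (fun i hi j hj hij => ?_) hC
  by_contra hne
  exact Set.disjoint_left.1 (hJ hi hj hne) (hg i hi).1 (hij ▸ (hg j hj).1)

theorem ncard_inter_pair_ne_one {α : Type u} {A : Set α} {a b : α} (h : a ∈ A ↔ b ∈ A) :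
    (A ∩ {a, b}).ncard ≠ 1 ∨ a = b := by
  by_cases hab : a = b
  · exact Or.inr hab
  refine Or.inl ?_
  by_cases ha : a ∈ A
  · rw [inter_eq_right.2 (by simp [insert_subset_iff, ha, h.1 ha]), ncard_pair hab]
    decide
  · have : A ∩ {a, b} = ∅ := by
      ext z
      simp only [mem_inter_iff, mem_insert_iff, mem_singleton_iff, mem_empty_iff_false, iff_false]
      rintro ⟨hz, rfl | rfl⟩
      exacts [ha hz, ha (h.2 hz)]
    simp [this]

variable {π : PowMod (finIdeal CantorSpace) ≃o PowMod (finIdeal CantorSpace)}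

/-- A family of size `ℵ₁` of disjoint deviations yields a cofinal selection family. -/
theorem exists_isCSNFamily_of_isDeviation
    (htriv : ∀ Z : Set CantorSpace, Z.Countable → IsTrivialOn π Z)
    {F : CantorSpace → CantorSpace}
    (hF : ∀ n, Represents π {x | x n = true} {y | F y n = true})
    {M : Set ((ℕ → CantorSpace) × (ℕ → CantorSpace))}
    (hM : ∀ p ∈ M, IsDeviation π F p.1 p.2)
    (hdisj : M.PairwiseDisjoint fun p => range p.1 ∪ range p.2) (hcard : #M = ℵ₁) :
    ∃ G, IsCSNFamily boldDelta11 G ∧ #G = ℵ₁ := by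
  classical
  have hdisj₁ : ∀ p ∈ M, ∀ q ∈ M, p ≠ q → Disjoint (range p.1) (range q.1) :=
    fun p hp q hq hpq => (hdisj hp hq hpq).mono subset_union_left subset_union_left
  have hdisj₂ : ∀ p ∈ M, ∀ q ∈ M, p ≠ q → Disjoint (range p.2) (range q.2) :=
    fun p hp q hq hpq => (hdisj hp hq hpq).mono subset_union_right subset_union_right
  obtain ⟨κ, hκ⟩ := exists_forall_eq_unpair (M := M) (fun p => p.1)
    (fun p hp => (hM p hp).injective_left) hdisj₁
  choose Y hY using fun k => exists_represents π {x | κ x = k}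
  set u : CantorSpace → CantorSpace := fun x m => decide (κ x = m) with hu
  -- The colour of x is to be read off from y alone: it is the least m with y ∈ `Y m`.
  set U : CantorSpace → CantorSpace := fun y m => decide (y ∈ Y m) with hU
  have huκ : ∀ x, firstTrue (u x) = κ x := fun x => by
    have : {m | u x m = true} = {κ x} := by
      ext m
      simp [hu, eq_comm]
    rw [firstTrue, this, csInf_singleton]
  have hlevel : ∀ k, CountablyRepresents π {x | κ x = k} {y | firstTrue (U y) = k} := by
    intro k
    have := CountablyRepresents.preimage htriv (φ := u) (φ' := U)
      (fun n => Represents.countablyRepresents (by simpa [hu, hU] using hY n))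
      (measurableSet_firstTrue_eq k)
    simpa [preimage, huκ] using this
  set ψ : CantorSpace → CantorSpace := fun x => spread (κ x) x with hψ
  set F' : CantorSpace → CantorSpace := fun y => spread (firstTrue (U y)) (F y) with hF'
  have hψinj : Function.Injective ψ := by
    intro x x' h
    have hk : κ x = κ x' := eq_of_spread_eq h
    simp only [hψ, hk] at h
    exact spread_injective _ h
  have hborel : ∀ A : Set CantorSpace, MeasurableSet A →
      CountablyRepresents π (ψ ⁻¹' A) (F' ⁻¹' A) := by
    intro A hA
    have h : ∀ k, CountablyRepresents π ({x | κ x = k} ∩ spread k ⁻¹' A)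
        ({y | firstTrue (U y) = k} ∩ F ⁻¹' (spread k ⁻¹' A)) := fun k =>
      (hlevel k).inter (CountablyRepresents.preimage htriv (φ := id)
        (fun n => (hF n).countablyRepresents) (measurable_spread k hA))
    have := CountablyRepresents.iUnion htriv h
    convert this using 1
    · ext x
      simp [hψ]
    · ext y
      simp [hF']
  -- For a fixed colour k only the finitely many classes j ≤ k matter, so the decoded colour is
  -- eventually right.
  have hgood : ∀ p ∈ M, ∀ k, ∀ᶠ n in Filter.atTop, κ (p.1 n) = k → firstTrue (U (p.2 n)) = k := by
    intro p hp k
    have h : ∀ᶠ n in Filter.atTop, ∀ j ∈ Finset.range (k + 1), (κ (p.1 n) = j ↔ p.2 n ∈ Y j) :=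
      (Filter.eventually_all_finset _).2 fun j _ => (hM p hp).eventually_iff _ _ (hY j)
    filter_upwards [h] with n hn hk
    simp only [Finset.mem_range, Nat.lt_succ_iff] at hn
    have hmem : k ∈ {m | U (p.2 n) m = true} := by
      simpa [hU] using (hn k le_rfl).1 hk
    refine le_antisymm (Nat.sInf_le hmem) (le_csInf ⟨k, hmem⟩ fun j hj => ?_)
    by_contra hjk
    have hj' : p.2 n ∈ Y j := by simpa [hU] using hj
    have := (hn j (not_le.1 hjk).le).2 hj'
    omega
  -- Keeping only the indices with correctly decoded colour makes both points of a pair pass through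
  -- the same injective spread, so they stay distinct; every colour still occurs.
  let N : (ℕ → CantorSpace) × (ℕ → CantorSpace) → Set ℕ := fun p =>
    {n | firstTrue (U (p.2 n)) = κ (p.1 n)}
  have hNk : ∀ p ∈ M, ∀ k, {n | n ∈ N p ∧ κ (p.1 n) = k}.Infinite := by
    intro p hp k
    rw [← Nat.frequently_atTop_iff_infinite]
    have hfreq : ∃ᶠ n in Filter.atTop, κ (p.1 n) = k := by
      rw [Nat.frequently_atTop_iff_infinite]
      refine (infinite_range_of_injective (f := fun j => Nat.pair k j) fun i j h => ?_).mono ?_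
      · simpa using h
      · rintro _ ⟨j, rfl⟩
        simp [hκ p hp]
    exact (hfreq.and_eventually (hgood p hp k)).mono fun n hn => ⟨(hn.2 hn.1).trans hn.1.symm, hn.1⟩
  have hNinf : ∀ p ∈ M, (N p).Infinite := fun p hp => (hNk p hp 0).mono fun n hn => hn.1
  let ν : (ℕ → CantorSpace) × (ℕ → CantorSpace) → ℕ → ℕ := fun p => Nat.nth (· ∈ N p)
  have hν : ∀ p ∈ M, ∀ n, ν p n ∈ N p := fun p hp n => Nat.nth_mem_of_infinite (hNinf p hp) n
  have hνtop : ∀ p ∈ M, Filter.Tendsto (ν p) Filter.atTop Filter.atTop := fun p hp =>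
    (Nat.nth_strictMono (hNinf p hp)).tendsto_atTop
  -- The second coordinate carries x, as disjointness is required there and `ψ` is injective,
  -- whereas F' need not be.
  let Φ : (ℕ → CantorSpace) × (ℕ → CantorSpace) → (ℕ → CantorSpace) × (ℕ → CantorSpace) :=
    fun p => (fun n => F' (p.2 (ν p n)), fun n => ψ (p.1 (ν p n)))
  have hΦdisj : ∀ p ∈ M, ∀ q ∈ M, p ≠ q → Disjoint (range (Φ p).2) (range (Φ q).2) := by
    intro p hp q hq hpq
    rw [Set.disjoint_left]
    rintro _ ⟨m, rfl⟩ ⟨n, hn⟩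
    exact Set.disjoint_left.1 (hdisj₁ p hp q hq hpq) ⟨ν p m, rfl⟩ ⟨ν q n, hψinj hn⟩
  have hΦinj : InjOn Φ M := by
    intro p hp q hq h
    by_contra hpq
    have := hΦdisj p hp q hq hpq
    rw [h, disjoint_self] at this
    exact (range_nonempty (Φ q).2).ne_empty this
  have hΦne : ∀ p ∈ M, ∀ n, (Φ p).1 n ≠ (Φ p).2 n := by
    intro p hp n h
    have hn : firstTrue (U (p.2 (ν p n))) = κ (p.1 (ν p n)) := hν p hp n
    simp only [Φ, hF', hψ, hn] at h
    exact (hM p hp).ne _ (spread_injective _ h)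
  have hGcard : #(Φ '' M) = ℵ₁ := by rw [Cardinal.mk_image_eq_of_injOn _ _ hΦinj, hcard]
  refine ⟨Φ '' M, ⟨?_, ?_, ?_, ?_⟩, hGcard⟩
  · rintro _ ⟨p, hp, rfl⟩
    refine dense_of_spread fun k => ?_
    obtain ⟨n, hn, hk⟩ := (hNk p hp k).nonempty
    obtain ⟨m, rfl⟩ : n ∈ range (ν p) := 
      (Nat.range_nth_of_infinite (hNinf p hp)).ge hn
    exact ⟨p.1 (ν p m), Or.inr ⟨m, by simp only [Φ, hψ, hk]⟩⟩
  · rintro _ ⟨p, hp, rfl⟩ _ ⟨q, hq, rfl⟩ hpq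
    exact hΦdisj p hp q hq fun h => hpq (by rw [h])
  · rintro _ ⟨p, hp, rfl⟩ n
    exact hΦne p hp n
  · rintro A ⟨hA, hAc⟩
    obtain ⟨B, hB, hcount⟩ := hborel A (hA.measurableSet_of_compl hAc)
    -- If y avoids the error set, then eventually ψ (x n) ∈ A iff y n ∈ B iff F' (y n) ∈ A.
    have hmeet : ∀ p ∈ M, (∃ᶠ n in Filter.atTop, (A ∩ {(Φ p).1 n, (Φ p).2 n}).ncard = 1) →
        ∃ n, p.2 n ∈ symmDiff B (F' ⁻¹' A) := by
      intro p hp hfreq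
      by_contra! hno
      refine hfreq ?_
      filter_upwards [(hνtop p hp).eventually ((hM p hp).eventually_iff _ _ hB)] with n hn
      have h₁ := hno (ν p n)
      refine (ncard_inter_pair_ne_one ?_).resolve_right (hΦne p hp n)
      rw [mem_symmDiff] at h₁
      simp only [mem_preimage] at h₁ hn
      simp only [Φ]
      tauto
    rw [hGcard, ← Cardinal.succ_aleph0, Order.lt_succ_iff, Cardinal.le_aleph0_iff_set_countable]
    have hsub : {p | p ∈ Φ '' M ∧
        ∃ᶠ n in Filter.atTop, (A ∩ {p.1 n, p.2 n}).ncard = 1} ⊆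
        Φ '' {p | p ∈ M ∧ ∃ n, p.2 n ∈ symmDiff B (F' ⁻¹' A)} := by
      rintro _ ⟨⟨p, hp, rfl⟩, hfreq⟩
      exact ⟨p, ⟨hp, hmeet p hp hfreq⟩, rfl⟩
    refine Countable.mono hsub (Countable.image ?_ Φ)
    refine PairwiseDisjoint.countable_of_inter_nonempty (s := fun p => range p.2)
      (fun p hp q hq => hdisj₂ p hp.1 q hq.1) hcount ?_
    rintro p ⟨-, n, hn⟩
    exact ⟨p.2 n, ⟨n, rfl⟩, hn⟩

/-- If `CSN(Δ¹₁) > ℵ₁`, then an automorphism that is trivial on countable sets, and whose inverse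
preserves countability, is trivial. -/
theorem isTrivial_of_aleph_one_lt_CSN (hCSN : ℵ₁ < CSN boldDelta11)
    (htriv : ∀ Z : Set CantorSpace, Z.Countable → IsTrivialOn π Z)
    (hrev : ∀ A B, Represents π A B → B.Countable → A.Countable) : IsTrivial π := by
  classical
  choose B hB using fun n => exists_represents π {x : CantorSpace | x n = true}
  set F : CantorSpace → CantorSpace := fun y n => decide (y ∈ B n) with hF
  have hFrep : ∀ n, Represents π {x | x n = true} {y | F y n = true} := by simpa [hF] using hB
  by_contra hnot
  obtain ⟨M, hM, hdisj, hcard⟩ := exists_pairwiseDisjoint_mk_eq_aleph_one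
    (fun p : (ℕ → CantorSpace) × (ℕ → CantorSpace) => range p.1 ∪ range p.2)
    (fun p => IsDeviation π F p.1 p.2)
    (fun p _ => (countable_range _).union (countable_range _))
    (fun p => (range_nonempty _).inl) (by
      intro S hS
      by_contra! hno
      refine hnot (isTrivial_of_almost_agrees htriv hrev F hS hS fun Z hZ hZS W f hf => ?_)
      by_contra hinf
      obtain ⟨x, y, hxy, hx, hy⟩ := hf.exists_isDeviation hinf
      exact hno (x, y) hxy (disjoint_union_left.2 ⟨hZS.mono_left hx, hy⟩))
  obtain ⟨G, hG, hGcard⟩ := exists_isCSNFamily_of_isDeviation htriv hFrep hM hdisj hcard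
  refine hCSN.not_ge ?_
  rw [CSN, if_pos ⟨G, hG⟩]
  exact csInf_le' ⟨G, hG, hGcard⟩

end CofinalSelection

/-! ### Generic points and cov(ℳ). -/

section Category

theorem exists_forall_mem_of_lt_covMeager {ι : Type} (s : ι → Set CantorSpace)
    (hs : ∀ i, s i ∈ residual CantorSpace) (hι : #ι < covMeager) : ∃ x, ∀ i, x ∈ s i := by
  by_contra! h
  refine hι.not_ge (le_trans (csInf_le' ?_) (Cardinal.mk_range_le (f := fun i => (s i)ᶜ)))
  refine ⟨range fun i => (s i)ᶜ, ?_, ?_, rfl⟩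
  · rintro _ ⟨i, rfl⟩
    simpa [IsMeagre] using hs i
  · refine eq_univ_of_forall fun x => ?_
    obtain ⟨i, hi⟩ := h x
    exact ⟨_, ⟨i, rfl⟩, hi⟩

theorem frequently_mem_residual {X : Type*} [TopologicalSpace X] {U : ℕ → Set X}
    (hU : ∀ n, IsOpen (U n)) (h : ∀ N, Dense (⋃ n ≥ N, U n)) :
    {x | ∃ᶠ n in Filter.atTop, x ∈ U n} ∈ residual X := by
  have : (⋂ N, ⋃ n ≥ N, U n) ∈ residual X := countable_iInter_mem.2 fun N =>
    residual_of_dense_open (isOpen_biUnion fun n _ => hU n) (h N)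
  refine Filter.mem_of_superset this fun x hx => ?_
  refine Filter.frequently_atTop.2 fun N => ?_
  simpa using mem_iInter.1 hx N

theorem isOpen_setOf_eval (i : ℕ) (b : Bool) : IsOpen {x : CantorSpace | x i = b} :=
  (isOpen_discrete ({b} : Set Bool)).preimage (continuous_apply (A := fun _ : ℕ => Bool) i)

/-- A generic sequence codes a function that infinitely often agrees with a given one. -/
theorem frequently_firstTrue_eq_mem_residual {S : Set ℕ} (hS : S.Infinite) (h : ℕ → ℕ) :
    {x : CantorSpace | ∃ᶠ n in Filter.atTop, n ∈ S ∧ firstTrue (fun m => x (n + m)) = h n} ∈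
      residual CantorSpace := by
  refine Filter.mem_of_superset (frequently_mem_residual (U := fun n => {x : CantorSpace |
    n ∈ S ∧ x (n + h n) = true ∧ ∀ m < h n, x (n + m) = false}) (fun n => ?_) fun N => ?_)
    fun x hx => Filter.Frequently.mono hx fun n hn => ⟨hn.1, ?_⟩
  · have : {x : CantorSpace | n ∈ S ∧ x (n + h n) = true ∧ ∀ m < h n, x (n + m) = false} =
        ⋃ (_ : n ∈ S), {x : CantorSpace | x (n + h n) = true} ∩
          ⋂ m ∈ Finset.range (h n), {x : CantorSpace | x (n + m) = false} := by
      ext x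
      simp only [mem_iUnion, mem_inter_iff, mem_iInter, Finset.mem_range, mem_ofPred_eq,
        exists_prop]
    rw [this]
    exact isOpen_iUnion fun _ => (isOpen_setOf_eval _ _).inter
      (isOpen_biInter_finset fun m _ => isOpen_setOf_eval _ _)
  · refine dense_of_forall_prefix fun z L => ?_
    obtain ⟨n, hnS, hn⟩ := hS.exists_gt (max N L)
    -- Follow z up to n > L, then place a single `true` at distance h n from n.
    refine ⟨fun m => if m < n then z m else decide (m = n + h n), ?_, fun m hm => ?_⟩
    · simp only [mem_iUnion]
      refine ⟨n, (le_max_left N L).trans hn.le, hnS, by simp, fun m hm => ?_⟩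
      simp [hm.ne]
    · simp only [hm.trans ((le_max_right N L).trans_lt hn), if_true]
  · refine le_antisymm (Nat.sInf_le hn.2.1) (le_csInf ⟨_, hn.2.1⟩ fun j hj => ?_)
    by_contra hlt
    have h₁ := hn.2.2 j (not_le.1 hlt)
    have h₂ : x (n + j) = true := hj
    simp [h₁] at h₂

/-- `k` is the first position at which `w` differs from the even part of `x`. -/
def FirstDiff (x w : CantorSpace) (k : ℕ) : Prop :=
  w k ≠ x (2 * k) ∧ ∀ m < k, w m = x (2 * m)

/-- The set of points `w` for which the odd part of `x` is `true` at the first position where `w`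
differs from the even part of `x`. -/
def genericSet (x : CantorSpace) : Set CantorSpace := {w | ∃ k, FirstDiff x w k ∧ x (2 * k + 1)}

theorem FirstDiff.unique {x w : CantorSpace} {k l : ℕ} (hk : FirstDiff x w k)
    (hl : FirstDiff x w l) : k = l := by
  rcases lt_trichotomy k l with h | h | h
  exacts [absurd (hl.2 k h) hk.1, h, absurd (hk.2 l h) hl.1]

theorem FirstDiff.mem_genericSet_iff {x w : CantorSpace} {k : ℕ} (hk : FirstDiff x w k) :
    w ∈ genericSet x ↔ x (2 * k + 1) = true :=
  ⟨fun ⟨_, hl, h⟩ => hk.unique hl ▸ h, fun h => ⟨k, hk, h⟩⟩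

theorem isOpen_setOf_firstDiff_left (w : CantorSpace) (k : ℕ) : IsOpen {x | FirstDiff x w k} := by
  have : {x | FirstDiff x w k} = {x : CantorSpace | x (2 * k) = !w k} ∩
      ⋂ m ∈ Finset.range k, {x : CantorSpace | x (2 * m) = w m} := by
    ext x
    simp only [FirstDiff, mem_ofPred_eq, mem_inter_iff, mem_iInter, Finset.mem_range]
    refine and_congr ?_ (forall₂_congr fun _ _ => eq_comm)
    cases w k <;> cases x (2 * k) <;> simp
  rw [this]
  exact (isOpen_setOf_eval _ _).inter (isOpen_biInter_finset fun m _ => isOpen_setOf_eval _ _)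

theorem isOpen_setOf_firstDiff_right (x : CantorSpace) (k : ℕ) : IsOpen {w | FirstDiff x w k} := by
  have : {w | FirstDiff x w k} = {w : CantorSpace | w k = !x (2 * k)} ∩
      ⋂ m ∈ Finset.range k, {w : CantorSpace | w m = x (2 * m)} := by
    ext w
    simp only [FirstDiff, mem_ofPred_eq, mem_inter_iff, mem_iInter, Finset.mem_range]
    refine and_congr ?_ Iff.rfl
    cases w k <;> cases x (2 * k) <;> simp
  rw [this]
  exact (isOpen_setOf_eval _ _).inter (isOpen_biInter_finset fun m _ => isOpen_setOf_eval _ _)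

theorem genericSet_mem_boldDelta11 (x : CantorSpace) : genericSet x ∈ boldDelta11 := by
  have : PolishSpace Bool := inferInstance
  have : IsOpen (genericSet x) := by
    have h : genericSet x = ⋃ (k) (_ : x (2 * k + 1) = true), {w | FirstDiff x w k} := by
      ext w
      simp [genericSet, and_comm]
    rw [h]
    exact isOpen_iUnion fun k => isOpen_iUnion fun _ => isOpen_setOf_firstDiff_right x k
  exact ⟨this.measurableSet.analyticSet, this.measurableSet.compl.analyticSet⟩

/-- A finite condition on `x` that makes `genericSet x` separate `w` and `w'`. -/
def Separates (x w w' : CantorSpace) : Prop :=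
  ∃ k l, FirstDiff x w k ∧ FirstDiff x w' l ∧ x (2 * k + 1) ≠ x (2 * l + 1)

theorem Separates.symm {x w w' : CantorSpace} (h : Separates x w w') : Separates x w' w := by
  obtain ⟨k, l, hk, hl, h⟩ := h
  exact ⟨l, k, hl, hk, h.symm⟩

theorem Separates.ncard_eq_one {x w w' : CantorSpace} (h : Separates x w w') :
    (genericSet x ∩ {w, w'}).ncard = 1 := by
  wlog hw : w ∈ genericSet x generalizing w w'
  · rw [pair_comm]
    refine this h.symm ?_
    obtain ⟨k, l, hk, hl, h⟩ := h
    rw [hk.mem_genericSet_iff] at hw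
    rw [hl.mem_genericSet_iff]
    cases h₁ : x (2 * k + 1) <;> cases h₂ : x (2 * l + 1) <;> simp_all
  have hw' : w' ∉ genericSet x := by
    obtain ⟨k, l, hk, hl, h⟩ := h
    rw [hk.mem_genericSet_iff] at hw
    rw [hl.mem_genericSet_iff]
    exact fun h' => h (hw.trans h'.symm)
  refine Set.ncard_eq_one.2 ⟨w, ?_⟩
  ext v
  simp only [mem_inter_iff, mem_insert_iff, mem_singleton_iff]
  constructor
  · rintro ⟨hv, rfl | rfl⟩
    exacts [rfl, absurd hv hw']
  · rintro rfl
    exact ⟨hw, Or.inl rfl⟩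

theorem isOpen_setOf_separates (w w' : CantorSpace) : IsOpen {x | Separates x w w'} := by
  have : {x | Separates x w w'} = ⋃ (k) (l), {x | FirstDiff x w k} ∩ {x | FirstDiff x w' l} ∩
      ⋃ b : Bool, {x : CantorSpace | x (2 * k + 1) = !b} ∩
        {x : CantorSpace | x (2 * l + 1) = b} := by
    ext x
    simp only [Separates, mem_ofPred_eq, mem_iUnion, mem_inter_iff, exists_eq_right', and_assoc]
    refine exists_congr fun k => exists_congr fun l => ?_
    refine and_congr_right fun _ => and_congr_right fun _ => ?_
    cases x (2 * k + 1) <;> cases x (2 * l + 1) <;> simp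
  rw [this]
  exact isOpen_iUnion fun k => isOpen_iUnion fun l =>
    ((isOpen_setOf_firstDiff_left w k).inter (isOpen_setOf_firstDiff_left w' l)).inter
      (isOpen_iUnion fun b => (isOpen_setOf_eval _ _).inter (isOpen_setOf_eval _ _))

/-- Let the even part of x follow w past d, the first difference of w and w', and leave w only at M.
Then w' is decided by the odd digit at d and w by the one at M, which can be chosen to differ. Only
w has to be near z, since density places just one point of a pair. -/
theorem exists_separates_of_prefix {w w' : CantorSpace} (hne : w ≠ w') (z : CantorSpace) {L : ℕ}
    (hw : ∀ m < L, w m = z (2 * m)) : ∃ x, Separates x w w' ∧ ∀ i < L, x i = z i := by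
  classical
  obtain ⟨d, hd, hlt⟩ : ∃ d, w d ≠ w' d ∧ ∀ m < d, w m = w' m := by
    have hex : ∃ d, w d ≠ w' d := Function.ne_iff.1 hne
    exact ⟨Nat.find hex, Nat.find_spec hex, fun m hm => not_not.1 (Nat.find_min hex hm)⟩
  set M := max L (d + 1) with hM
  have hLM : L ≤ M := le_max_left _ _
  have hdM : d < M := le_max_right L (d + 1)
  set x : CantorSpace := fun i =>
    if i % 2 = 0 then (if i / 2 = M then !w (i / 2) else w (i / 2))
    else if i / 2 = M then !z (2 * d + 1) else z i with hx
  have heven : ∀ m, x (2 * m) = if m = M then !w m else w m := fun m => by simp [hx]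
  have hodd : ∀ m, x (2 * m + 1) = if m = M then !z (2 * d + 1) else z (2 * m + 1) := fun m => by
    have h₁ : (2 * m + 1) / 2 = m := by omega
    have h₂ : (2 * m + 1) % 2 ≠ 0 := by omega
    simp only [hx, h₁, h₂, if_false]
  refine ⟨x, ⟨M, d, ⟨?_, fun m hm => ?_⟩, ⟨?_, fun m hm => ?_⟩, ?_⟩, fun i hi => ?_⟩
  · simp [heven]
  · simp [heven, hm.ne]
  · simpa [heven, hdM.ne] using hd.symm
  · simpa [heven, (hm.trans hdM).ne] using (hlt m hm).symm
  · simp [hodd, hdM.ne]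
  · obtain ⟨m, rfl | rfl⟩ := Nat.even_or_odd' i
    · rw [heven, if_neg (by omega), hw m (by omega)]
    · rw [hodd, if_neg (by omega)]

theorem frequently_separates_mem_residual {f g : ℕ → CantorSpace}
    (hdense : Dense (range f ∪ range g)) (hne : ∀ n, f n ≠ g n) :
    {x | ∃ᶠ n in Filter.atTop, Separates x (f n) (g n)} ∈ residual CantorSpace := by
  refine frequently_mem_residual (U := fun n => {x | Separates x (f n) (g n)})
    (fun n => isOpen_setOf_separates _ _) fun N => dense_of_forall_prefix fun z L => ?_
  have hperf : ∀ x : CantorSpace, (nhdsWithin x {x}ᶜ).NeBot := fun x => by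
    rw [← mem_closure_iff_nhdsWithin_neBot]
    refine dense_of_forall_prefix (fun z L => ?_) x
    refine ⟨fun m => if m < L then z m else !x m, fun h => ?_, fun m hm => if_pos hm⟩
    simpa using congrFun h L
  have hfin : (f '' Iio N ∪ g '' Iio N).Finite :=
    ((finite_Iio N).image f).union ((finite_Iio N).image g)
  -- The space has no isolated points, so dropping the pairs with index below N preserves density.
  have hd := hdense.sdiff_finite hfin
  have hopen : IsOpen {w : CantorSpace | ∀ m < L, w m = z (2 * m)} := by
    have : {w : CantorSpace | ∀ m < L, w m = z (2 * m)} =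
        ⋂ m ∈ Finset.range L, {w : CantorSpace | w m = z (2 * m)} := by
      ext w
      simp
    rw [this]
    exact isOpen_biInter_finset fun m _ => isOpen_setOf_eval _ _
  obtain ⟨w, ⟨hw, hwN⟩, hwL⟩ := hd.exists_mem_open hopen ⟨fun m => z (2 * m), fun m _ => rfl⟩
  have key : ∃ n ≥ N, ∃ x, Separates x (f n) (g n) ∧ ∀ i < L, x i = z i := by
    rcases hw with ⟨n, rfl⟩ | ⟨n, rfl⟩
    · refine ⟨n, ?_, exists_separates_of_prefix (hne n) z hwL⟩
      by_contra hn
      exact hwN (Or.inl ⟨n, not_le.1 hn, rfl⟩)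
    · refine ⟨n, ?_, ?_⟩
      · by_contra hn
        exact hwN (Or.inr ⟨n, not_le.1 hn, rfl⟩)
      · obtain ⟨x, hx, hxz⟩ := exists_separates_of_prefix (hne n).symm z hwL
        exact ⟨x, hx.symm, hxz⟩
  obtain ⟨n, hn, x, hx, hxz⟩ := key
  exact ⟨x, mem_biUnion hn hx, hxz⟩

/-- Were G smaller, one x would be generic for all its members, and the exceptional subfamily of
`genericSet x` would be all of G. -/
theorem covMeager_le_mk_of_isCSNFamily {G : Set ((ℕ → CantorSpace) × (ℕ → CantorSpace))}
    (hG : IsCSNFamily boldDelta11 G) : covMeager ≤ #G := by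
  by_contra hlt
  obtain ⟨x, hx⟩ := exists_forall_mem_of_lt_covMeager
    (fun p : G => {x | ∃ᶠ n in Filter.atTop, Separates x (p.1.1 n) (p.1.2 n)})
    (fun p => frequently_separates_mem_residual (hG.dense _ p.2) (hG.ne _ p.2)) (not_le.1 hlt)
  refine (hG.small _ (genericSet_mem_boldDelta11 x)).ne (congrArg _ ?_)
  congr 1
  ext p
  exact ⟨fun h => h.1, fun hp => ⟨hp, (hx ⟨p, hp⟩).mono fun n hn => hn.ncard_eq_one⟩⟩

theorem aleph_one_lt_CSN_of_lt_covMeager (h : ℵ₁ < covMeager) : ℵ₁ < CSN boldDelta11 := by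
  classical
  rw [CSN]
  split_ifs with hex
  · obtain ⟨G, hG⟩ := hex
    obtain ⟨G', hG', hcard⟩ := csInf_mem (s := {κ | ∃ F, IsCSNFamily boldDelta11 F ∧ #F = κ})
      ⟨_, G, hG, rfl⟩
    rw [← hcard]
    exact h.trans_le (covMeager_le_mk_of_isCSNFamily hG')
  · rw [Order.lt_succ_iff, ← Cardinal.succ_aleph0, Order.succ_le_iff]
    exact Cardinal.cantor _

/-! ### Uncountable sets do not have countable images. -/

variable {X Y : Type} {π : PowMod (finIdeal X) ≃o PowMod (finIdeal Y)}

/-- If `cov(ℳ) > ℵ₁`, then an isomorphism cannot map an uncountable set to a countable one. -/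
theorem Represents.countable_of_aleph_one_lt_covMeager (hcov : ℵ₁ < covMeager) {D : Set X}
    {C : Set Y} (h : Represents π D C) (hC : C.Countable) : D.Countable := by
  classical
  by_contra hD
  have hle : ℵ₁ ≤ #D := by
    rw [← Cardinal.succ_aleph0, Order.succ_le_iff, ← not_le, Cardinal.le_aleph0_iff_set_countable]
    exact hD
  obtain ⟨ι, hι⟩ : ∃ ι : Type, #ι = ℵ₁ := ⟨_, Cardinal.mk_out _⟩
  have hprod : #(ι × ℕ) ≤ #D := by
    rw [Cardinal.mk_prod, Cardinal.lift_id, Cardinal.lift_id, hι, Cardinal.mk_nat,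
      Cardinal.mul_aleph0_eq (Cardinal.aleph0_le_aleph 1)]
    exact hle
  -- An ℵ₁ × ω array inside D: `B n` will represent its columns and `G a` its rows.
  obtain ⟨v⟩ := Cardinal.le_def _ _ |>.1 hprod
  have hv : Function.Injective fun p => (v p : X) := Subtype.val_injective.comp v.injective
  have hpair : ∀ {a b m n}, (v (a, m) : X) = v (b, n) → a = b ∧ m = n := fun h => by
    simpa using hv h
  choose B hB using fun n => exists_represents π (range fun a => (v (a, n) : X))
  choose G hG using fun a => exists_represents π (range fun n => (v (a, n) : X))
  obtain ⟨C₀, hC₀⟩ := exists_represents π (range fun p => (v p : X))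
  have hC₀C : (C₀ \ C).Finite := by
    rw [← hC₀.finite_diff_iff h, sdiff_eq_empty.2 (range_subset_iff.2 fun p => (v p).2)]
    exact finite_empty
  have hC₀c : C₀.Countable := (hC.union hC₀C.countable).mono fun y hy => by
    by_cases hyC : y ∈ C
    exacts [Or.inl hyC, Or.inr ⟨hy, hyC⟩]
  obtain ⟨idx, hidx⟩ := countable_iff_exists_injOn.1 hC₀c
  -- The preimage of such a T meets each column in a finite set, so it is countable and meets only
  -- countably many of the disjoint rows. The aim is a T that violates this.
  have key : ∀ T, T ⊆ C₀ → (∀ n, (T ∩ B n).Finite) → {a | (T ∩ G a).Infinite}.Countable := by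
    intro T hT hTB
    obtain ⟨E, hE⟩ := exists_represents_of_image π T
    have h₁ : (E \ range fun p => (v p : X)).Finite := by
      rw [hE.finite_diff_iff hC₀, sdiff_eq_empty.2 hT]
      exact finite_empty
    have h₂ : ∀ n, (E ∩ range fun a => (v (a, n) : X)).Finite := fun n =>
      (hE.finite_inter_iff (hB n)).2 (hTB n)
    have hEc : E.Countable := by
      refine (h₁.countable.union (countable_iUnion fun n => (h₂ n).countable)).mono fun x hx => ?_
      by_cases hxv : x ∈ range fun p => (v p : X)
      · obtain ⟨⟨a, n⟩, rfl⟩ := hxv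
        exact Or.inr (mem_iUnion.2 ⟨n, hx, a, rfl⟩)
      · exact Or.inl ⟨hx, hxv⟩
    refine PairwiseDisjoint.countable_of_inter_nonempty
      (s := fun a => range fun n => (v (a, n) : X)) ?_ hEc fun a ha => ?_
    · intro a _ b _ hab
      refine Set.disjoint_left.2 ?_
      rintro _ ⟨m, rfl⟩ ⟨n, hn⟩
      exact hab (hpair hn).1.symm
    · rw [inter_comm]
      exact Set.Infinite.nonempty fun hfin => ha ((hE.finite_inter_iff (hG a)).1 hfin)
  set lev : Y → ℕ := fun c => sInf {n | c ∈ B n} with hlev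
  have hlev_mem : ∀ c ∈ ⋃ n, B n, c ∈ B (lev c) := fun c hc =>
    Nat.sInf_mem (s := {n | c ∈ B n}) (mem_iUnion.1 hc)
  set bad : Set ι := {a | ((C₀ \ ⋃ n, B n) ∩ G a).Infinite} with hbad
  have hbadc : bad.Countable := key _ sdiff_subset fun n => by
    convert finite_empty
    ext c
    simp only [mem_inter_iff, mem_sdiff, mem_iUnion, mem_empty_iff_false, iff_false]
    grind
  set H : ι → Set Y := fun a => C₀ ∩ (⋃ n, B n) ∩ G a with hH
  have hHinf : ∀ a ∉ bad, (H a).Infinite := by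
    intro a ha hfin
    have h₁ : (G a \ C₀).Finite := by
      rw [← (hG a).finite_diff_iff hC₀, sdiff_eq_empty.2]
      · exact finite_empty
      · rintro _ ⟨n, rfl⟩
        exact ⟨_, rfl⟩
    have h₂ : (G a).Infinite := fun hfin' =>
      infinite_range_of_injective (fun m n hmn => (hpair hmn).2) ((hG a).finite_iff.2 hfin')
    refine h₂ ((h₁.union (hfin.union (not_infinite.1 ha))).subset fun c hc => ?_)
    simp only [hH, mem_union, mem_sdiff, mem_inter_iff]
    tauto
  -- A row meets a column in one point, so `G a` meets each `B n` in a finite set and infinitely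
  -- many levels occur.
  have hlevinf : ∀ a ∉ bad, (lev '' H a).Infinite := by
    intro a ha hfin
    have hGB : ∀ n, (G a ∩ B n).Finite := fun n => by
      rw [← (hG a).finite_inter_iff (hB n)]
      refine (finite_singleton (v (a, n) : X)).subset ?_
      rintro _ ⟨⟨m, rfl⟩, b, hb⟩
      rw [(hpair hb).2]
      rfl
    refine hHinf a ha ((hfin.biUnion fun n _ => hGB n).subset fun c hc => ?_)
    exact mem_biUnion (mem_image_of_mem lev hc) ⟨hc.2, hlev_mem c hc.1.2⟩
  have hsel : ∀ a n, ∃ c, n ∈ lev '' H a → c ∈ H a ∧ lev c = n := fun a n => by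
    by_cases hn : n ∈ lev '' H a
    · obtain ⟨c, hc⟩ := hn
      exact ⟨c, fun _ => hc⟩
    · have : Nonempty Y := by
        by_contra hY
        rw [not_nonempty_iff] at hY
        exact hD (h.finite_iff.2 C.toFinite).countable
      exact ⟨Classical.arbitrary Y, fun h => absurd h hn⟩
  choose c hc using hsel
  obtain ⟨x, hx⟩ := exists_forall_mem_of_lt_covMeager
    (fun a : {a // a ∉ bad} => {x : CantorSpace | ∃ᶠ n in Filter.atTop,
      n ∈ lev '' H a ∧ firstTrue (fun m => x (n + m)) = idx (c a n)})
    (fun a => frequently_firstTrue_eq_mem_residual (hlevinf a a.2) _)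
    (((Cardinal.mk_subtype_le _).trans hι.le).trans_lt hcov)
  set r : ℕ → ℕ := fun n => firstTrue fun m => x (n + m) with hr
  -- Points of `B n` have level at most n, so their `idx` is bounded by r on the levels up to n.
  -- Genericity of r puts infinitely many points of every good row into this set.
  have hcount := key {y | y ∈ C₀ ∧ y ∈ ⋃ n, B n ∧ idx y ≤ r (lev y)} (fun y hy => hy.1) (by
    intro n
    have hfin : ∀ k, {y | y ∈ C₀ ∧ idx y ≤ k}.Finite := fun k =>
      Finite.of_finite_image ((finite_Iic k).subset (by rintro _ ⟨y, hy, rfl⟩; exact hy.2))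
        (hidx.mono fun y hy => hy.1)
    refine ((finite_Iic n).biUnion fun j _ => hfin (r j)).subset ?_
    rintro y ⟨⟨hy, -, hyr⟩, hyB⟩
    exact mem_biUnion (show lev y ∈ Iic n from Nat.sInf_le hyB) ⟨hy, hyr⟩)
  have huniv : (univ : Set ι).Countable := (hbadc.union hcount).mono fun a _ => by
    by_cases ha : a ∈ bad
    · exact Or.inl ha
    refine Or.inr ?_
    have hinf := Nat.frequently_atTop_iff_infinite.1 (hx ⟨a, ha⟩)
    have hinj : InjOn (c a) {n | n ∈ lev '' H a ∧ r n = idx (c a n)} := fun m hm n hn hmn => by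
      rw [← (hc a m hm.1).2, ← (hc a n hn.1).2, hmn]
    refine (hinf.image hinj).mono ?_
    rintro _ ⟨n, ⟨hn, hrn⟩, rfl⟩
    obtain ⟨hcH, hcl⟩ := hc a n hn
    exact ⟨⟨hcH.1.1, hcH.1.2, by rw [hcl]; exact hrn.ge⟩, hcH.2⟩
  rw [countable_univ_iff, ← Cardinal.mk_le_aleph0_iff, hι] at huniv
  exact huniv.not_gt Cardinal.aleph0_lt_aleph_one

end Category

theorem theorem4p3 :
    (ℵ₁ < CSN boldDelta11 →
      ∀ π : PowMod (finIdeal CantorSpace) ≃o PowMod (finIdeal CantorSpace),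
        IsCardPreserving π →
        (∀ Z : Set CantorSpace, Z.Countable → IsTrivialOn π Z) →
        IsTrivial π) ∧
    (ℵ₁ < covMeager →
      ∀ π : PowMod (finIdeal CantorSpace) ≃o PowMod (finIdeal CantorSpace),
        (∀ Z : Set CantorSpace, Z.Countable → IsTrivialOn π Z) →
        IsTrivial π) := by
  refine ⟨fun hCSN π hcard htriv => isTrivial_of_aleph_one_lt_CSN hCSN htriv ?_,
    fun hcov π htriv => isTrivial_of_aleph_one_lt_CSN (aleph_one_lt_CSN_of_lt_covMeager hcov) htriv
      fun A B h hB => h.countable_of_aleph_one_lt_covMeager hcov hB⟩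
  intro A B h hB
  -- The representative of the same cardinality as A differs from B by a finite set, so it is
  -- countable.
  obtain ⟨B', hAB', hB'⟩ := hcard A
  have hB'c : B'.Countable := (hB.union (Represents.finite_diff_right hB' h).countable).mono
    fun y hy => by
      by_cases hyB : y ∈ B
      exacts [Or.inl hyB, Or.inr ⟨hy, hyB⟩]
  rwa [← Cardinal.le_aleph0_iff_set_countable, hAB', Cardinal.le_aleph0_iff_set_countable]
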